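/- Let $0<\gamma\le\infty$ and let $\psi:[0,\gamma)\to[0,\infty)$ be a non-zero increasing (i.e. non-decreasing) concave function, continuous on $(0,\gamma)$, with $\psi(0)=0$. Let $L_0(0,\gamma)$ be the space of (classes modulo a.e. equality of) real-valued Lebesgue measurable functions on $(0,\gamma)$, ordered pointwise a.e. For $f\in L_0(0,\gamma)$ let $f^*(s)=\inf\{r\ge 0: m(\{x\in(0,\gamma):|f(x)|>r\})\le s\}$, $s\ge 0$, be its decreasing rearrangement ($m$ is Lebesgue measure, $\inf\emptyset=\infty$), and put $$\|f\|_{M_\psi}=\sup_{0<t<\gamma}\frac1{\psi(t)}\int_0^t f^*(s)\,ds .$$ Let $M_\psi(0,\gamma)=\{f\in L_0(0,\gamma):\|f\|_{M_\psi}<\infty\}$ be the Marcinkiewicz space, a Banach lattice with this norm and the a.e. order. Suppose that one of the following two conditions holds: (A) $\gamma=\infty$, $\ \liminf_{t\downarrow 0}\dfrac{\psi(2t)}{\psi(t)}>1$ and $\liminf_{t\to\infty}\dfrac{\psi(2t)}{\psi(t)}>1$; (B) $\gamma<\infty$ and $\liminf_{t\downarrow 0}\dfrac{\psi(2t)}{\psi(t)}>1$.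 Then the norm of the dual Banach lattice $M_\psi(0,\gamma)^*$ (ordered by $\varphi_1\le\varphi_2$ iff $\varphi_1(f)\le\varphi_2(f)$ for all $0\le f\in M_\psi(0,\gamma)$) is order continuous, i.e. $\|\varphi_\tau\|\to 0$ for every net $\varphi_\tau\downarrow 0$ (decreasing with infimum $0$) in $M_\psi(0,\gamma)^*$. -/

import Mathlib

open MeasureTheory Filter Topology Set
open scoped ENNReal NNReal

namespace Marc

section Rearrangement

variable {α : Type*} [MeasurableSpace α]

/-- The distribFunution function `d_{|f|}(r) = μ {x : |f x| > r}`. -/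
noncomputable def distribFun (μ : Measure α) (f : α → ℝ) (r : ℝ) : ℝ≥0∞ :=
  μ {x | r < |f x|}

/-- The decreasing rearrangement `f^*(s) = inf {r ≥ 0 : d_{|f|}(r) ≤ s}`, for `s ≥ 0`
(the infimum of the empty set is `∞`). -/
noncomputable def rearr (μ : Measure α) (f : α → ℝ) (s : ℝ) : ℝ≥0∞ :=
  ⨅ (r : ℝ≥0) (_ : distribFun μ f r ≤ ENNReal.ofReal s), (r : ℝ≥0∞)

/-- `∫_0^t f^*(s) ds`. -/
noncomputable def rearrInt (μ : Measure α) (f : α → ℝ) (t : ℝ) : ℝ≥0∞ :=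
  ∫⁻ s in Ioc 0 t, rearr μ f s

theorem distribFun_antitone (μ : Measure α) (f : α → ℝ) : Antitone (distribFun μ f) :=
  fun _ _ h => measure_mono fun _ hx => lt_of_le_of_lt h hx

theorem distribFun_mono {μ : Measure α} {f g : α → ℝ} (h : ∀ᵐ x ∂μ, |f x| ≤ |g x|) (r : ℝ) :
    distribFun μ f r ≤ distribFun μ g r := by
  refine measure_mono_ae ?_
  filter_upwards [h] with x hx hr
  exact lt_of_lt_of_le (show r < |f x| from hr) hx

theorem rearr_mono {μ : Measure α} {f g : α → ℝ} (h : ∀ᵐ x ∂μ, |f x| ≤ |g x|) (s : ℝ) :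
    rearr μ f s ≤ rearr μ g s :=
  le_iInf₂ fun r hr => iInf₂_le r ((distribFun_mono h r).trans hr)

theorem rearrInt_mono {μ : Measure α} {f g : α → ℝ} (h : ∀ᵐ x ∂μ, |f x| ≤ |g x|) (t : ℝ) :
    rearrInt μ f t ≤ rearrInt μ g t :=
  lintegral_mono fun s => rearr_mono h s

theorem rearr_antitone (μ : Measure α) (f : α → ℝ) : Antitone (rearr μ f) :=
  fun _ _ h => le_iInf₂ fun r hr => iInf₂_le r (hr.trans (ENNReal.ofReal_le_ofReal h))

theorem rearr_le_iff (μ : Measure α) (f : α → ℝ) (s : ℝ) (r : ℝ≥0) :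
    rearr μ f s ≤ r ↔ distribFun μ f r ≤ ENNReal.ofReal s := by
  refine ⟨fun h => ?_, fun h => iInf₂_le r h⟩
  have key : ∀ r' : ℝ≥0, r < r' → distribFun μ f r' ≤ ENNReal.ofReal s := by
    intro r' hr'
    have h1 : rearr μ f s < r' := h.trans_lt (by exact_mod_cast hr')
    unfold rearr at h1
    simp only [iInf_lt_iff] at h1
    obtain ⟨q, hq, hqr⟩ := h1
    have hqr' : (q : ℝ) ≤ r' := by exact_mod_cast hqr.le
    exact (distribFun_antitone μ f hqr').trans hq
  have hU : {x | (r : ℝ) < |f x|} = ⋃ n : ℕ, {x | (r : ℝ) + 1 / ((n : ℝ) + 1) < |f x|} := by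
    ext x
    simp only [mem_ofPred_eq, mem_iUnion]
    constructor
    · intro hx
      obtain ⟨n, hn⟩ := exists_nat_one_div_lt (sub_pos.2 hx)
      exact ⟨n, by linarith⟩
    · rintro ⟨n, hn⟩
      have : 0 < 1 / ((n : ℝ) + 1) := by positivity
      linarith
  have hmono : Monotone fun n : ℕ => {x | (r : ℝ) + 1 / ((n : ℝ) + 1) < |f x|} := by
    intro m n hmn x hx
    simp only [mem_ofPred_eq] at hx ⊢
    have : 1 / ((n : ℝ) + 1) ≤ 1 / ((m : ℝ) + 1) := Nat.one_div_le_one_div hmn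
    linarith
  unfold distribFun
  rw [hU, hmono.measure_iUnion]
  refine iSup_le fun n => ?_
  have h2 := key (r + 1 / ((n : ℝ≥0) + 1)) (lt_add_of_pos_right _ (by positivity))
  simpa [distribFun] using h2

theorem volume_ofReal_lt (a : ℝ≥0∞) :
    volume {r : ℝ | 0 < r ∧ ENNReal.ofReal r < a} = a := by
  induction a with
  | top =>
    have : {r : ℝ | 0 < r ∧ ENNReal.ofReal r < ⊤} = Ioi 0 := by ext; simp
    rw [this, Real.volume_Ioi]
  | coe a =>
    have : {r : ℝ | 0 < r ∧ ENNReal.ofReal r < a} = Ioo 0 (a : ℝ) := by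
      ext r
      simp only [mem_ofPred_eq, mem_Ioo]
      refine and_congr_right fun hr => ?_
      rw [← ENNReal.ofReal_coe_nnreal, ENNReal.ofReal_lt_ofReal_iff_of_nonneg hr.le]
    rw [this, Real.volume_Ioo, sub_zero, ENNReal.ofReal_coe_nnreal]

theorem rearrInt_eq (μ : Measure α) (f : α → ℝ) (t : ℝ) :
    rearrInt μ f t = ∫⁻ r in Ioi (0 : ℝ), min (distribFun μ f r) (ENNReal.ofReal t) := by
  have hm : MeasurableSet {p : ℝ × ℝ | ENNReal.ofReal p.1 < distribFun μ f p.2} :=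
    measurableSet_lt (ENNReal.measurable_ofReal.comp measurable_fst)
      ((distribFun_antitone μ f).measurable.comp measurable_snd)
  have h1 : ∀ s : ℝ, rearr μ f s = ∫⁻ r in Ioi (0 : ℝ),
      {p : ℝ × ℝ | ENNReal.ofReal p.1 < distribFun μ f p.2}.indicator 1 (s, r) := by
    intro s
    have hms : MeasurableSet {r : ℝ | ENNReal.ofReal s < distribFun μ f r} :=
      measurableSet_lt measurable_const (distribFun_antitone μ f).measurable
    have : (fun r : ℝ => {p : ℝ × ℝ | ENNReal.ofReal p.1 < distribFun μ f p.2}.indicator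
        (1 : ℝ × ℝ → ℝ≥0∞) (s, r)) =
        {r : ℝ | ENNReal.ofReal s < distribFun μ f r}.indicator 1 := by
      ext r; simp [indicator]
    rw [this, lintegral_indicator_one hms, Measure.restrict_apply hms]
    conv_lhs => rw [← volume_ofReal_lt (rearr μ f s)]
    congr 1
    ext r
    simp only [mem_ofPred_eq, mem_inter_iff, mem_Ioi]
    rw [and_comm]
    refine and_congr_left fun hr => ?_
    have := rearr_le_iff μ f s ⟨r, hr.le⟩
    rw [← not_le, ← not_le, not_iff_not, ← NNReal.coe_mk r hr.le, ENNReal.ofReal_coe_nnreal]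
    exact this
  unfold rearrInt
  simp_rw [h1]
  rw [lintegral_lintegral_swap]
  · refine lintegral_congr fun r => ?_
    have hms : MeasurableSet {s : ℝ | ENNReal.ofReal s < distribFun μ f r} :=
      measurableSet_lt ENNReal.measurable_ofReal measurable_const
    have : (fun s : ℝ => {p : ℝ × ℝ | ENNReal.ofReal p.1 < distribFun μ f p.2}.indicator
        (1 : ℝ × ℝ → ℝ≥0∞) (s, r)) =
        {s : ℝ | ENNReal.ofReal s < distribFun μ f r}.indicator 1 := by
      ext s; simp [indicator]
    rw [this, lintegral_indicator_one hms, restrict_Ioo_eq_restrict_Ioc.symm,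
      Measure.restrict_apply hms]
    conv_rhs => rw [← volume_ofReal_lt (min _ _)]
    congr 1
    ext s
    simp only [mem_ofPred_eq, mem_inter_iff, mem_Ioo, lt_min_iff]
    constructor
    · rintro ⟨h, h0, h2⟩
      exact ⟨h0, h, (ENNReal.ofReal_lt_ofReal_iff_of_nonneg h0.le).2 h2⟩
    · rintro ⟨h0, h, h2⟩
      exact ⟨h, h0, (ENNReal.ofReal_lt_ofReal_iff_of_nonneg h0.le).1 h2⟩
  · exact (measurable_one.indicator hm).aemeasurable

theorem lintegral_excess {μ : Measure α} {f : α → ℝ} (hf : AEMeasurable f μ) (c : ℝ) :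
    ∫⁻ x, ENNReal.ofReal (|f x| - c) ∂μ = ∫⁻ r in Ioi c, distribFun μ f r := by
  have h0 : ∀ x, ENNReal.ofReal (|f x| - c) = ENNReal.ofReal (max (|f x| - c) 0) := by
    intro x; rw [ENNReal.ofReal_max, ENNReal.ofReal_zero, max_eq_left zero_le]
  simp_rw [h0]
  have hm : AEMeasurable (fun x => max (|f x| - c) 0) μ :=
    (hf.norm.sub_const c).max aemeasurable_const
  have hn : 0 ≤ᵐ[μ] fun x => max (|f x| - c) 0 :=
    Eventually.of_forall fun x => le_max_right _ _
  rw [lintegral_eq_lintegral_meas_lt μ hn hm]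
  have h1 := (measurePreserving_add_left volume c).setLIntegral_comp_preimage
    (measurableSet_Ioi (a := c)) (distribFun_antitone μ f).measurable
  rw [← h1]
  have h2 : (fun x : ℝ => c + x) ⁻¹' Ioi c = Ioi 0 := by ext; simp
  rw [h2]
  refine setLIntegral_congr_fun measurableSet_Ioi fun r hr => ?_
  unfold distribFun
  congr 1
  ext x
  simp only [mem_ofPred_eq, lt_max_iff]
  constructor
  · rintro (h | h)
    · linarith
    · exact absurd h (not_lt.2 (le_of_lt hr))
  · intro h; left; linarith

theorem rearrInt_le {μ : Measure α} {f : α → ℝ} (hf : AEMeasurable f μ) (t : ℝ) {c : ℝ}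
    (hc : 0 ≤ c) :
    rearrInt μ f t ≤
      ENNReal.ofReal t * ENNReal.ofReal c + ∫⁻ x, ENNReal.ofReal (|f x| - c) ∂μ := by
  rw [rearrInt_eq, lintegral_excess hf, ← Ioc_union_Ioi_eq_Ioi hc]
  refine (lintegral_union_le _ _ _).trans (add_le_add ?_ ?_)
  · refine (lintegral_mono fun r => min_le_right _ _).trans ?_
    simp
  · exact lintegral_mono fun r => min_le_left _ _

theorem rearr_ne_top {μ : Measure α} {f : α → ℝ} {t : ℝ} (ht : 0 < t)
    (h : rearrInt μ f t ≠ ⊤) : rearr μ f t ≠ ⊤ := by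
  intro htop
  apply h
  rw [eq_top_iff]
  have h1 : ∫⁻ _ in Ioc 0 t, (⊤ : ℝ≥0∞) ≤ rearrInt μ f t :=
    setLIntegral_mono' measurableSet_Ioc fun s hs => by
      rw [← htop]; exact rearr_antitone μ f hs.2
  refine le_trans ?_ h1
  simp [ENNReal.top_mul, ht]

theorem le_rearrInt {μ : Measure α} {f : α → ℝ} (hf : AEMeasurable f μ) {t : ℝ}
    (h : rearr μ f t ≠ ⊤) :
    ENNReal.ofReal t * ENNReal.ofReal (rearr μ f t).toReal +
      ∫⁻ x, ENNReal.ofReal (|f x| - (rearr μ f t).toReal) ∂μ ≤ rearrInt μ f t := by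
  set c : ℝ≥0 := (rearr μ f t).toNNReal with hc
  have hcr : (rearr μ f t).toReal = c := rfl
  have hcc : rearr μ f t = c := (ENNReal.coe_toNNReal h).symm
  rw [hcr, rearrInt_eq, lintegral_excess hf, ← Ioc_union_Ioi_eq_Ioi c.2]
  rw [lintegral_union measurableSet_Ioi (by
    rw [Set.disjoint_left]; intro r h1 h2; exact absurd h1.2 (not_le.2 h2)),
    ← restrict_Ioo_eq_restrict_Ioc]
  refine add_le_add ?_ ?_
  · have h1 : ∫⁻ _ in Ioo 0 (c : ℝ), ENNReal.ofReal t ≤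
        ∫⁻ r in Ioo 0 (c : ℝ), min (distribFun μ f r) (ENNReal.ofReal t) := by
      refine setLIntegral_mono' measurableSet_Ioo fun r hr => le_min ?_ le_rfl
      by_contra hlt
      have h2 := (rearr_le_iff μ f t ⟨r, hr.1.le⟩).2 (not_le.1 hlt).le
      rw [hcc] at h2
      have h3 : c ≤ ⟨r, hr.1.le⟩ := ENNReal.coe_le_coe.1 h2
      exact absurd hr.2 (not_lt.2 h3)
    refine le_trans ?_ h1
    simp
  · refine setLIntegral_mono' measurableSet_Ioi fun r hr => le_min le_rfl ?_
    exact (distribFun_antitone μ f (le_of_lt hr)).trans ((rearr_le_iff μ f t c).1 hcc.le)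

theorem rearrInt_add_le {μ : Measure α} {f g : α → ℝ} (hf : AEMeasurable f μ)
    (hg : AEMeasurable g μ) {t : ℝ} (ht : 0 < t) :
    rearrInt μ (fun x => f x + g x) t ≤ rearrInt μ f t + rearrInt μ g t := by
  by_cases hF : rearrInt μ f t = ⊤
  · simp [hF]
  by_cases hG : rearrInt μ g t = ⊤
  · simp [hG]
  have h1 := le_rearrInt hf (rearr_ne_top ht hF)
  have h2 := le_rearrInt hg (rearr_ne_top ht hG)
  set a := (rearr μ f t).toReal
  set b := (rearr μ g t).toReal
  have ha : 0 ≤ a := ENNReal.toReal_nonneg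
  have hb : 0 ≤ b := ENNReal.toReal_nonneg
  refine (rearrInt_le (hf.add hg) t (add_nonneg ha hb)).trans
    (le_trans ?_ (add_le_add h1 h2))
  have h3 : ∫⁻ x, ENNReal.ofReal (|f x + g x| - (a + b)) ∂μ ≤
      ∫⁻ x, ENNReal.ofReal (|f x| - a) ∂μ + ∫⁻ x, ENNReal.ofReal (|g x| - b) ∂μ := by
    have hm : AEMeasurable (fun x => ENNReal.ofReal (|f x| - a)) μ :=
      (hf.norm.sub_const a).ennreal_ofReal
    rw [← lintegral_add_left' hm]
    refine lintegral_mono fun x => ?_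
    refine (ENNReal.ofReal_le_ofReal ?_).trans ENNReal.ofReal_add_le
    have := abs_add_le (f x) (g x)
    linarith
  rw [ENNReal.ofReal_add ha hb, mul_add]
  calc _ ≤ _ := add_le_add le_rfl h3
    _ = _ := by ring

theorem rearr_const_mul_le (μ : Measure α) (f : α → ℝ) (c : ℝ) (s : ℝ) :
    rearr μ (fun x => c * f x) s ≤ ENNReal.ofReal |c| * rearr μ f s := by
  by_cases htop : rearr μ f s = ⊤
  · by_cases hc : c = 0
    · subst hc
      have : rearr μ (fun x => 0 * f x) s ≤ (0 : ℝ≥0) := by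
        rw [rearr_le_iff]; simp [distribFun]
      simpa using this
    · rw [htop, ENNReal.mul_top (by simpa using hc)]
      exact le_top
  · obtain ⟨r, hr⟩ : ∃ r : ℝ≥0, (r : ℝ≥0∞) = rearr μ f s :=
      ⟨_, ENNReal.coe_toNNReal htop⟩
    have h1 := (rearr_le_iff μ f s r).1 hr.ge
    have h2 : distribFun μ (fun x => c * f x) ((Real.nnabs c * r : ℝ≥0) : ℝ) ≤ ENNReal.ofReal s := by
      refine le_trans (measure_mono fun x hx => ?_) h1
      simp only [mem_ofPred_eq, NNReal.coe_mul, Real.coe_nnabs, abs_mul] at hx ⊢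
      exact lt_of_mul_lt_mul_left hx (abs_nonneg c)
    have h3 := (rearr_le_iff μ _ s _).2 h2
    rw [← hr, ← Real.coe_nnabs, ENNReal.ofReal_coe_nnreal, ← ENNReal.coe_mul]
    exact h3

theorem rearrInt_const_mul_le (μ : Measure α) (f : α → ℝ) (c : ℝ) (t : ℝ) :
    rearrInt μ (fun x => c * f x) t ≤ ENNReal.ofReal |c| * rearrInt μ f t := by
  unfold rearrInt
  rw [← lintegral_const_mul' _ _ ENNReal.ofReal_ne_top]
  exact lintegral_mono fun s => rearr_const_mul_le μ f c s

end Rearrangement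

/-- The half-open interval `[0, γ)`, for `0 ≤ γ ≤ ∞`. -/
def ico (γ : ℝ≥0∞) : Set ℝ := {t | 0 ≤ t ∧ ENNReal.ofReal t < γ}

/-- The open interval `(0, γ)`, for `0 ≤ γ ≤ ∞`. -/
def ioo (γ : ℝ≥0∞) : Set ℝ := {t | 0 < t ∧ ENNReal.ofReal t < γ}

/-- Lebesgue measure on `(0, γ)`. -/
noncomputable def leb (γ : ℝ≥0∞) : Measure ℝ := volume.restrict (ioo γ)

/-- `L_0(0, γ)`: real measurable functions on `(0, γ)` modulo equality almost everywhere. -/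
abbrev L0 (γ : ℝ≥0∞) : Type := ℝ →ₘ[leb γ] ℝ

instance (γ : ℝ≥0∞) : IsOrderedAddMonoid (L0 γ) where
  add_le_add_left f g h k := by
    rw [← AEEqFun.coeFn_le] at h ⊢
    filter_upwards [h, AEEqFun.coeFn_add f k, AEEqFun.coeFn_add g k] with x hx h1 h2
    rw [h1, h2]
    simpa using hx

/-- `sup_{0<t<γ} ψ(t)⁻¹ ∫_0^t f^*(s) ds`, as an element of `[0, ∞]`. -/
noncomputable def mnorm (γ : ℝ≥0∞) (ψ : ℝ → ℝ) (f : L0 γ) : ℝ≥0∞ :=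
  ⨆ t ∈ ioo γ, rearrInt (leb γ) f t / ENNReal.ofReal (ψ t)

section Gauge

variable {γ : ℝ≥0∞} {ψ : ℝ → ℝ}

theorem ae_abs_le_abs {f g : L0 γ} (h : |f| ≤ |g|) : ∀ᵐ x ∂leb γ, |f x| ≤ |g x| := by
  have h' := AEEqFun.coeFn_le.2 h
  filter_upwards [h', AEEqFun.coeFn_abs f, AEEqFun.coeFn_abs g] with x hx h1 h2
  rwa [h1, h2] at hx

theorem mnorm_mono {f g : L0 γ} (h : |f| ≤ |g|) : mnorm γ ψ f ≤ mnorm γ ψ g :=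
  iSup₂_mono fun t _ => ENNReal.div_le_div_right (rearrInt_mono (ae_abs_le_abs h) t) _

theorem mnorm_add_le (f g : L0 γ) : mnorm γ ψ (f + g) ≤ mnorm γ ψ f + mnorm γ ψ g := by
  refine iSup₂_le fun t ht => ?_
  have h1 : rearrInt (leb γ) (f + g : L0 γ) t ≤
      rearrInt (leb γ) f t + rearrInt (leb γ) g t := by
    refine le_trans (rearrInt_mono ?_ t)
      (rearrInt_add_le f.aemeasurable g.aemeasurable ht.1)
    filter_upwards [AEEqFun.coeFn_add f g] with x hx
    rw [hx]; simp
  refine (ENNReal.div_le_div_right h1 _).trans ?_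
  rw [ENNReal.add_div]
  exact add_le_add
    (le_iSup₂ (f := fun t (_ : t ∈ ioo γ) => rearrInt (leb γ) f t / ENNReal.ofReal (ψ t)) t ht)
    (le_iSup₂ (f := fun t (_ : t ∈ ioo γ) => rearrInt (leb γ) g t / ENNReal.ofReal (ψ t)) t ht)

theorem mnorm_smul_le (c : ℝ) (f : L0 γ) :
    mnorm γ ψ (c • f) ≤ ENNReal.ofReal |c| * mnorm γ ψ f := by
  refine iSup₂_le fun t ht => ?_
  have h1 : rearrInt (leb γ) (c • f : L0 γ) t ≤ ENNReal.ofReal |c| * rearrInt (leb γ) f t := by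
    refine le_trans (rearrInt_mono ?_ t) (rearrInt_const_mul_le _ _ _ _)
    filter_upwards [AEEqFun.coeFn_smul c f] with x hx
    rw [hx]; simp
  refine (ENNReal.div_le_div_right h1 _).trans ?_
  rw [mul_div_assoc]
  gcongr
  exact le_iSup₂ (f := fun t (_ : t ∈ ioo γ) =>
    rearrInt (leb γ) f t / ENNReal.ofReal (ψ t)) t ht

theorem mnorm_zero : mnorm γ ψ 0 = 0 := by
  simpa using mnorm_smul_le (ψ := ψ) 0 (0 : L0 γ)

theorem mnorm_neg (f : L0 γ) : mnorm γ ψ (-f) = mnorm γ ψ f :=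
  le_antisymm (mnorm_mono (abs_neg f).le) (mnorm_mono (abs_neg f).ge)

theorem eq_zero_of_mnorm (f : L0 γ) (h : mnorm γ ψ f = 0) : f = 0 := by
  have h1 : ∀ t ∈ ioo γ, distribFun (leb γ) f 0 ≤ ENNReal.ofReal t := by
    intro t ht
    have h2 : rearrInt (leb γ) f t / ENNReal.ofReal (ψ t) = 0 := by
      simp only [mnorm, ENNReal.iSup_eq_zero] at h
      exact h t ht
    rw [ENNReal.div_eq_zero_iff] at h2
    have h3 := h2.resolve_right ENNReal.ofReal_ne_top
    have h4 : ∫⁻ _ in Ioc 0 t, rearr (leb γ) f t ≤ rearrInt (leb γ) f t :=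
      setLIntegral_mono' measurableSet_Ioc fun s hs => rearr_antitone _ _ hs.2
    rw [h3, nonpos_iff_eq_zero] at h4
    have h5 : rearr (leb γ) f t = 0 := by
      have := ht.1
      simpa [not_le.2 this] using h4
    simpa using (rearr_le_iff (leb γ) f t 0).1 (by simp [h5])
  have h6 : distribFun (leb γ) f 0 = 0 := by
    by_cases hγ : γ = 0
    · have : ioo γ = ∅ := by ext; simp [ioo, hγ]
      simp [distribFun, leb, this]
    · rw [← nonpos_iff_eq_zero]
      refine le_of_forall_gt fun ε hε => ?_
      obtain ⟨q, hq0, hq⟩ := ENNReal.lt_iff_exists_nnreal_btwn.1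
        (lt_min hε (pos_iff_ne_zero.2 hγ))
      have hq' : (q : ℝ) ∈ ioo γ :=
        ⟨by exact_mod_cast hq0, by
          rw [ENNReal.ofReal_coe_nnreal]; exact hq.trans_le (min_le_right _ _)⟩
      refine (h1 q hq').trans_lt ?_
      rw [ENNReal.ofReal_coe_nnreal]; exact hq.trans_le (min_le_left _ _)
  apply AEEqFun.ext
  have h7 : ∀ᵐ x ∂leb γ, ¬ (0 < |f x|) := by
    rw [ae_iff]; simpa [distribFun] using h6
  filter_upwards [h7, AEEqFun.coeFn_zero (α := ℝ) (μ := leb γ) (β := ℝ)] with x hx h0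
  rw [h0]
  simpa using hx

end Gauge

/-- The Marcinkiewicz space `M_ψ(0, γ) = {f ∈ L_0(0, γ) : ‖f‖ < ∞}`. -/
def Marcinkiewicz (γ : ℝ≥0∞) (ψ : ℝ → ℝ) : Submodule ℝ (L0 γ) where
  carrier := {f | mnorm γ ψ f < ⊤}
  zero_mem' := by simp [mnorm_zero]
  add_mem' := fun hf hg => (mnorm_add_le _ _).trans_lt (ENNReal.add_lt_top.2 ⟨hf, hg⟩)
  smul_mem' := fun c _ hf =>
    (mnorm_smul_le c _).trans_lt (ENNReal.mul_lt_top ENNReal.ofReal_lt_top hf)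

section Space

variable {γ : ℝ≥0∞} {ψ : ℝ → ℝ}

theorem mem_of_abs_le {f g : L0 γ} (h : |f| ≤ |g|) (hg : g ∈ Marcinkiewicz γ ψ) :
    f ∈ Marcinkiewicz γ ψ :=
  (mnorm_mono h).trans_lt hg

theorem abs_mem {f : L0 γ} (hf : f ∈ Marcinkiewicz γ ψ) : |f| ∈ Marcinkiewicz γ ψ :=
  mem_of_abs_le (abs_abs f).le hf

theorem abs_le_abs_abs_add (f g : L0 γ) {h : L0 γ} (h1 : h ≤ |f| + |g|)
    (h2 : -h ≤ |f| + |g|) : |h| ≤ |(|f| + |g|)| :=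
  (abs_le'.2 ⟨h1, h2⟩).trans (le_abs_self _)

theorem sup_mem {f g : L0 γ} (hf : f ∈ Marcinkiewicz γ ψ) (hg : g ∈ Marcinkiewicz γ ψ) :
    f ⊔ g ∈ Marcinkiewicz γ ψ := by
  refine mem_of_abs_le (abs_le_abs_abs_add f g ?_ ?_) (add_mem (abs_mem hf) (abs_mem hg))
  · exact sup_le ((le_abs_self f).trans (le_add_of_nonneg_right (abs_nonneg g)))
      ((le_abs_self g).trans (le_add_of_nonneg_left (abs_nonneg f)))
  · exact (neg_le_neg le_sup_left).trans
      ((neg_le_abs f).trans (le_add_of_nonneg_right (abs_nonneg g)))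

theorem inf_mem {f g : L0 γ} (hf : f ∈ Marcinkiewicz γ ψ) (hg : g ∈ Marcinkiewicz γ ψ) :
    f ⊓ g ∈ Marcinkiewicz γ ψ := by
  have h := neg_mem (sup_mem (neg_mem hf) (neg_mem hg))
  rwa [neg_sup, neg_neg, neg_neg] at h

/-- `M_ψ(0, γ)` with the almost everywhere pointwise order is a vector lattice. -/
noncomputable instance : Lattice (Marcinkiewicz γ ψ) :=
  Subtype.lattice (fun _ _ hf hg => sup_mem hf hg) (fun _ _ hf hg => inf_mem hf hg)

/-- The Marcinkiewicz norm. -/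
noncomputable instance : NormedAddCommGroup (Marcinkiewicz γ ψ) :=
  AddGroupNorm.toNormedAddCommGroup
    { toFun := fun f => (mnorm γ ψ (f : L0 γ)).toReal
      map_zero' := by simp [mnorm_zero]
      add_le' := fun f g => by
        rw [← ENNReal.toReal_add f.2.ne g.2.ne]
        exact ENNReal.toReal_mono (ENNReal.add_ne_top.2 ⟨f.2.ne, g.2.ne⟩) (mnorm_add_le _ _)
      neg' := fun f => by simp [mnorm_neg]
      eq_zero_of_map_eq_zero' := fun f hf => by
        rw [ENNReal.toReal_eq_zero_iff] at hf
        exact Subtype.ext (eq_zero_of_mnorm _ (hf.resolve_right f.2.ne)) }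

theorem norm_def (f : Marcinkiewicz γ ψ) : ‖f‖ = (mnorm γ ψ (f : L0 γ)).toReal := rfl

noncomputable instance : NormedSpace ℝ (Marcinkiewicz γ ψ) where
  norm_smul_le c f := by
    rw [norm_def, norm_def, Real.norm_eq_abs, ← ENNReal.toReal_ofReal (abs_nonneg c),
      ← ENNReal.toReal_mul]
    exact ENNReal.toReal_mono (ENNReal.mul_ne_top ENNReal.ofReal_ne_top f.2.ne)
      (mnorm_smul_le _ _)

instance : IsOrderedAddMonoid (Marcinkiewicz γ ψ) where
  add_le_add_left _ _ h k := add_le_add_left (α := L0 γ) h k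

instance : HasSolidNorm (Marcinkiewicz γ ψ) where
  solid f g h := ENNReal.toReal_mono g.2.ne (mnorm_mono (show |(f : L0 γ)| ≤ |(g : L0 γ)| from h))

end Space

/-- The order of the dual of a normed lattice: `φ₁ ≤ φ₂` iff `φ₁ x ≤ φ₂ x` for all `x ≥ 0`. -/
@[reducible] def dualOrder (E : Type*) [NormedAddCommGroup E] [NormedSpace ℝ E] [Lattice E]
    [IsOrderedAddMonoid E] : PartialOrder (StrongDual ℝ E) where
  le φ₁ φ₂ := ∀ x : E, 0 ≤ x → φ₁ x ≤ φ₂ x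
  le_refl _ _ _ := le_rfl
  le_trans _ _ _ h₁ h₂ x hx := (h₁ x hx).trans (h₂ x hx)
  le_antisymm φ₁ φ₂ h₁ h₂ := by
    have h : ∀ x : E, 0 ≤ x → φ₁ x = φ₂ x := fun x hx => le_antisymm (h₁ x hx) (h₂ x hx)
    ext x
    rw [← posPart_sub_negPart x, map_sub, map_sub, h _ (posPart_nonneg x),
      h _ (negPart_nonneg x)]

noncomputable instance (γ : ℝ≥0∞) (ψ : ℝ → ℝ) : PartialOrder (StrongDual ℝ (Marcinkiewicz γ ψ)) :=
  dualOrder (Marcinkiewicz γ ψ)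

/-- The norm is order continuous: if a downward directed set `D`, viewed as a decreasing net,
has infimum `0`, then the net converges to `0` in norm. -/
def HasOrderContinuousNorm (F : Type*) [NormedAddCommGroup F] [PartialOrder F] : Prop :=
  ∀ D : Set F, D.Nonempty → DirectedOn (fun x y => y ≤ x) D → IsGLB D 0 →
    ∀ ε : ℝ, 0 < ε → ∃ x ∈ D, ∀ y ∈ D, y ≤ x → ‖y‖ < ε

/-- `γ = ∞`, `liminf_{t ↓ 0} ψ(2t)/ψ(t) > 1` and `liminf_{t → ∞} ψ(2t)/ψ(t) > 1`. -/
def ConditionA (γ : ℝ≥0∞) (ψ : ℝ → ℝ) : Prop :=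
  γ = ⊤ ∧
    (1 : EReal) < liminf (fun t : ℝ => ((ψ (2 * t) / ψ t : ℝ) : EReal)) (𝓝[>] 0) ∧
    (1 : EReal) < liminf (fun t : ℝ => ((ψ (2 * t) / ψ t : ℝ) : EReal)) atTop

/-- `γ < ∞` and `liminf_{t ↓ 0} ψ(2t)/ψ(t) > 1`. -/
def ConditionB (γ : ℝ≥0∞) (ψ : ℝ → ℝ) : Prop :=
  γ < ⊤ ∧
    (1 : EReal) < liminf (fun t : ℝ => ((ψ (2 * t) / ψ t : ℝ) : EReal)) (𝓝[>] 0)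

end Marc

namespace Marc

/-! ### A criterion for order continuity of the dual norm of a normed lattice. -/

section NormedLattice

variable {E : Type*} [NormedAddCommGroup E] [NormedSpace ℝ E] [Lattice E]

/-! Two facts combine. In a normed lattice, suppose that averages of long disjoint families in the
positive unit ball are uniformly small. Then the dual norm is order continuous
(`hasOrderContinuousNorm_dual`). Otherwise a downward directed set with infimum `0` stays at norm at
least `ε`. It converges pointwise to `0` by weak* compactness, so a gliding hump yields functionals
`φ i` below a fixed `φ₀` and unit-ball vectors `f i ≥ 0` with `φ i (f i) > ε / 2` and `φ i (f j)`
tiny for `j < i`. Subtracting suitable multiples of the other vectors makes the `f i` disjoint and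
costs at most `ε / 4`, so `φ₀` is at least `ε / 4` on the average of the new vectors, which
contradicts their small norm.

In the Marcinkiewicz space the smallness comes from geometric decay `ψ (t / 2 ^ k) ≤ A q ^ k ψ t`
with `q < 1`, uniform in `t`, which the liminf conditions supply (`exists_decay`). The distribution
functions of disjoint functions add up, so the sum `h` of `2 ^ N` disjoint unit-ball elements
satisfies `h^*(2 ^ N u) ≤ ψ u / u`. Summing over dyadic intervals bounds the norm of the average by
`A q ^ (N + 1) / (1 - q)` (`norm_sum_le_of_disjoint`). -/

theorem posPart_smul_of_pos [PosSMulMono ℝ E] {c : ℝ} (hc : 0 < c) (x : E) : (c • x)⁺ = c • x⁺ := by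
  have := (OrderIso.smulRight (β := E) hc).map_sup x 0
  simp only [OrderIso.smulRight_apply, smul_zero] at this
  rw [posPart_def, posPart_def, this]

variable [IsOrderedAddMonoid E]

/-- A positive functional satisfies `|φ x| ≤ φ |x|`. -/
theorem abs_apply_le_apply_abs {φ : StrongDual ℝ E} (hφ : ∀ x : E, 0 ≤ x → 0 ≤ φ x) (x : E) :
    |φ x| ≤ φ |x| := by
  have h1 := hφ (|x| - x) (sub_nonneg.2 (le_abs_self x))
  have h2 := hφ (|x| + x) (neg_le_iff_add_nonneg.1 (neg_le_abs x))
  rw [map_sub] at h1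
  rw [map_add] at h2
  exact abs_le.2 ⟨by linarith, by linarith⟩

theorem apply_mono {φ : StrongDual ℝ E} (hφ : ∀ x : E, 0 ≤ x → 0 ≤ φ x) {x y : E}
    (h : x ≤ y) : φ x ≤ φ y := by
  have := hφ (y - x) (sub_nonneg.2 h)
  rw [map_sub] at this
  linarith

/-- The second factor is `K` times the negative part of `x - K⁻¹ • y`, and positive and negative
parts are disjoint. This is the device that makes vectors disjoint. -/
theorem posPart_sub_smul_inf_eq_zero [PosSMulMono ℝ E] {K : ℝ} (hK : 1 ≤ K) (x y : E) :
    (x - K⁻¹ • y)⁺ ⊓ (y - K • x)⁺ = 0 := by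
  have hK0 : 0 < K := one_pos.trans_le hK
  have h1 : (y - K • x)⁺ = K • (x - K⁻¹ • y)⁻ := by
    rw [← posPart_neg, ← posPart_smul_of_pos hK0, neg_sub, smul_sub, smul_inv_smul₀ hK0.ne']
  rw [h1]
  refine le_antisymm ?_ (le_inf (posPart_nonneg _) (smul_nonneg hK0.le (negPart_nonneg _)))
  set a := x - K⁻¹ • y
  have h2 : a⁺ ≤ K • a⁺ := by
    have : 0 ≤ (K - 1) • a⁺ := smul_nonneg (sub_nonneg.2 hK) (posPart_nonneg a)
    rwa [sub_smul, one_smul, sub_nonneg] at this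
  have h3 := (OrderIso.smulRight (β := E) hK0).map_inf a⁺ a⁻
  rw [posPart_inf_negPart_eq_zero] at h3
  simp only [OrderIso.smulRight_apply, smul_zero] at h3
  rw [h3]
  exact inf_le_inf_right _ h2

variable [HasSolidNorm E]

theorem norm_le_norm_of_dual_le {φ φ₀ : StrongDual ℝ E} (hφ : ∀ x : E, 0 ≤ x → 0 ≤ φ x)
    (h : ∀ x : E, 0 ≤ x → φ x ≤ φ₀ x) : ‖φ‖ ≤ ‖φ₀‖ := by
  refine φ.opNorm_le_bound (norm_nonneg _) fun x => ?_
  calc ‖φ x‖ ≤ φ |x| := abs_apply_le_apply_abs hφ x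
    _ ≤ φ₀ |x| := h _ (abs_nonneg x)
    _ ≤ ‖φ₀‖ * ‖|x|‖ := (le_abs_self _).trans (φ₀.le_opNorm _)
    _ = ‖φ₀‖ * ‖x‖ := by rw [norm_abs_eq_norm]

/-- The norm of a positive functional is attained, up to `ε`, on the positive part of the unit
ball. -/
theorem exists_nonneg_lt_apply [PosSMulMono ℝ E] {φ : StrongDual ℝ E}
    (hφ : ∀ x : E, 0 ≤ x → 0 ≤ φ x) {c : ℝ} (hc : 0 ≤ c) (h : c < ‖φ‖) :
    ∃ x : E, 0 ≤ x ∧ ‖x‖ ≤ 1 ∧ c < φ x := by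
  by_contra! H
  refine absurd (φ.opNorm_le_bound hc fun x => ?_) (not_le.2 h)
  refine (abs_apply_le_apply_abs hφ x).trans ?_
  rcases eq_or_ne x 0 with rfl | hx
  · simp
  have hx' : 0 < ‖x‖ := norm_pos_iff.2 hx
  have h1 := H (‖x‖⁻¹ • |x|) (smul_nonneg (by positivity) (abs_nonneg x)) (by
    rw [norm_smul, norm_abs_eq_norm, norm_inv, norm_norm, inv_mul_cancel₀ hx'.ne'])
  rw [map_smul, smul_eq_mul, inv_mul_le_iff₀ hx'] at h1
  linarith

/-- A downward directed set of functionals with infimum `0` converges to `0` pointwise. -/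
theorem exists_apply_lt_of_isGLB {D : Set (StrongDual ℝ E)}
    (hdir : DirectedOn (fun φ θ => (dualOrder E).le θ φ) D)
    (hglb : @IsGLB _ (dualOrder E).toLE D 0) {φ₀ : StrongDual ℝ E} (h₀ : φ₀ ∈ D)
    {x : E} (hx : 0 ≤ x) {η : ℝ} (hη : 0 < η) :
    ∃ φ ∈ D, (dualOrder E).le φ φ₀ ∧ φ x < η := by
  by_contra! H
  have hpos : ∀ φ ∈ D, ∀ y : E, 0 ≤ y → 0 ≤ φ y := fun φ hφ y hy => hglb.1 hφ y hy
  let ι := {φ // φ ∈ D ∧ (dualOrder E).le φ φ₀}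
  -- Each set is weak* compact by Banach–Alaoglu and contains `φ` itself, and the family is
  -- directed. A common point would be a lower bound of `D` with value at least `η > 0` at `x`.
  let K : ι → Set (WeakDual ℝ E) := fun φ =>
    (WeakDual.toStrongDual ⁻¹' Metric.closedBall (0 : StrongDual ℝ E) ‖φ₀‖) ∩
      ({θ | ∀ y : E, 0 ≤ y → θ y ≤ φ.1 y} ∩ {θ | η ≤ θ x})
  have hcl : ∀ φ : StrongDual ℝ E, IsClosed ({θ : WeakDual ℝ E | ∀ y : E, 0 ≤ y → θ y ≤ φ y} ∩
      {θ | η ≤ θ x}) := by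
    intro φ
    refine IsClosed.inter ?_ (isClosed_le continuous_const (WeakDual.eval_continuous x))
    simp only [ofPred_forall]
    exact isClosed_iInter fun y => isClosed_iInter fun _ =>
      isClosed_le (WeakDual.eval_continuous y) continuous_const
  have hK : ∀ φ, IsCompact (K φ) := fun φ =>
    (WeakDual.isCompact_closedBall (0 : StrongDual ℝ E) ‖φ₀‖).inter_right (hcl φ.1)
  have : Nonempty ι := ⟨⟨φ₀, h₀, (dualOrder E).le_refl φ₀⟩⟩
  obtain ⟨θ, hθ⟩ := IsCompact.nonempty_iInter_of_directed_nonempty_isCompact_isClosed K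
    (by
      intro φ φ'
      obtain ⟨ξ, hξ, h1, h2⟩ := hdir φ.1 φ.2.1 φ'.1 φ'.2.1
      refine ⟨⟨ξ, hξ, (dualOrder E).le_trans _ _ _ h1 φ.2.2⟩, ?_, ?_⟩
      · exact fun θ hθ => ⟨hθ.1, fun y hy => (hθ.2.1 y hy).trans (h1 y hy), hθ.2.2⟩
      · exact fun θ hθ => ⟨hθ.1, fun y hy => (hθ.2.1 y hy).trans (h2 y hy), hθ.2.2⟩)
    (fun φ => by
      refine ⟨StrongDual.toWeakDual φ.1, ?_, fun y _ => le_rfl, H φ.1 φ.2.1 φ.2.2⟩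
      have := norm_le_norm_of_dual_le (hpos φ.1 φ.2.1) φ.2.2
      simpa using this)
    hK (fun φ => (hK φ).isClosed)
  rw [mem_iInter] at hθ
  have hle : (dualOrder E).le (WeakDual.toStrongDual θ) 0 := by
    refine hglb.2 fun φ hφ y hy => ?_
    -- The intersection only ranges over members of `D` below `φ₀`, so `φ` is replaced by a member
    -- below both.
    obtain ⟨ξ, hξ, h1, h2⟩ := hdir φ hφ φ₀ h₀
    exact ((hθ ⟨ξ, hξ, h2⟩).2.1 y hy).trans (h1 y hy)
  have h3 : η ≤ θ x := (hθ ⟨φ₀, h₀, (dualOrder E).le_refl φ₀⟩).2.2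
  have h4 : θ x ≤ 0 := hle x hx
  linarith

/-- If averages of long pairwise disjoint families in the positive part of the unit ball are
uniformly small, then the dual norm is order continuous. -/
theorem hasOrderContinuousNorm_dual [PosSMulMono ℝ E]
    (hE : ∀ ε : ℝ, 0 < ε → ∃ n : ℕ, 0 < n ∧ ∀ g : ℕ → E,
      (∀ i, 0 ≤ g i) → (∀ i, ‖g i‖ ≤ 1) →
      (∀ i < n, ∀ j < n, i ≠ j → g i ⊓ g j = 0) → ‖∑ i ∈ Finset.range n, g i‖ ≤ ε * n) :
    @HasOrderContinuousNorm (StrongDual ℝ E) _ (dualOrder E) := by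
  intro D hne hdir hglb ε hε
  obtain ⟨φ₀, h₀⟩ := hne
  have hpos : ∀ φ ∈ D, ∀ y : E, 0 ≤ y → 0 ≤ φ y := fun φ hφ y hy => hglb.1 hφ y hy
  suffices H : ∃ φ ∈ D, ‖φ‖ < ε by
    obtain ⟨φ, hφ, hlt⟩ := H
    exact ⟨φ, hφ, fun θ hθ hle => (norm_le_norm_of_dual_le (hpos θ hθ) hle).trans_lt hlt⟩
  by_contra! H
  set B := ‖φ₀‖ with hB
  have hB0 : 0 ≤ B := norm_nonneg _
  obtain ⟨n, hn, hdisj⟩ := hE (ε / (8 * (B + 1))) (by positivity)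
  have hn' : (0 : ℝ) < n := by exact_mod_cast hn
  -- `K` and `η` are chosen so that `B / K` and `K η` are both at most `ε / (4 n)`; the `n`
  -- correction terms then cost at most `ε / 4` in total.
  set K : ℝ := 4 * n * B / ε + 1 with hK
  have hK1 : 1 ≤ K := by
    have : 0 ≤ 4 * n * B / ε := by positivity
    linarith
  have hK0 : 0 < K := one_pos.trans_le hK1
  set η : ℝ := ε / (4 * n * K) with hη
  have hη0 : 0 < η := by positivity
  obtain ⟨p, hp, hr⟩ := exists_seq_of_forall_finset_exists
    (fun p : StrongDual ℝ E × E => p.1 ∈ D ∧ (dualOrder E).le p.1 φ₀ ∧ 0 ≤ p.2 ∧ ‖p.2‖ ≤ 1 ∧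
      ε / 2 < p.1 p.2) (fun p p' => p'.1 p.2 < η) (by
    intro s hs
    have hs0 : 0 ≤ ∑ q ∈ s, q.2 := Finset.sum_nonneg fun q hq => (hs q hq).2.2.1
    -- Smallness on the sum of the earlier vectors gives smallness on each one, by positivity.
    obtain ⟨φ, hφ, hle, hlt⟩ := exists_apply_lt_of_isGLB hdir hglb h₀ hs0 hη0
    obtain ⟨x, hx0, hx1, hx⟩ := exists_nonneg_lt_apply (hpos φ hφ) (half_pos hε).le
      ((half_lt_self hε).trans_le (H φ hφ))
    refine ⟨(φ, x), ⟨hφ, hle, hx0, hx1, hx⟩, fun q hq => lt_of_le_of_lt ?_ hlt⟩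
    exact apply_mono (hpos φ hφ)
      (Finset.single_le_sum (f := fun q : StrongDual ℝ E × E => q.2)
        (fun q hq => (hs q hq).2.2.1) hq))
  set φ : ℕ → StrongDual ℝ E := fun i => (p i).1
  set f : ℕ → E := fun i => (p i).2
  have hφD : ∀ i, φ i ∈ D := fun i => (hp i).1
  have hφ0 : ∀ i, ∀ x : E, 0 ≤ x → φ i x ≤ φ₀ x := fun i => (hp i).2.1
  have hf0 : ∀ i, 0 ≤ f i := fun i => (hp i).2.2.1
  have hf1 : ∀ i, ‖f i‖ ≤ 1 := fun i => (hp i).2.2.2.1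
  have hφf : ∀ i, ε / 2 < φ i (f i) := fun i => (hp i).2.2.2.2
  have hφη : ∀ j i, j < i → φ i (f j) < η := hr
  -- Earlier vectors, on which `φ i` is tiny, can be subtracted with the large factor `K`; later
  -- ones, where only the bound `B` is known, get the factor `K⁻¹`.
  set c : ℕ → ℕ → ℝ := fun i j => if j < i then K else if i < j then K⁻¹ else 0 with hc
  have hc0 : ∀ i j, 0 ≤ c i j := by
    intro i j
    simp only [hc]
    split_ifs <;> positivity
  have hcf : ∀ i j, 0 ≤ c i j • f j := fun i j => smul_nonneg (hc0 i j) (hf0 j)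
  set g : ℕ → E := fun i => (f i - ∑ j ∈ Finset.range n, c i j • f j)⁺ with hg
  have hg0 : ∀ i, 0 ≤ g i := fun i => posPart_nonneg _
  have hgf : ∀ i, g i ≤ f i := fun i =>
    sup_le (sub_le_self _ (Finset.sum_nonneg fun j _ => hcf i j)) (hf0 i)
  have hg1 : ∀ i, ‖g i‖ ≤ 1 := fun i => by
    refine (HasSolidNorm.solid ?_).trans (hf1 i)
    rw [abs_of_nonneg (hg0 i), abs_of_nonneg (hf0 i)]
    exact hgf i
  -- Keeping a single subtracted term only enlarges the positive part, so disjointness reduces to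
  -- pairs.
  have hgle : ∀ i, ∀ j < n, g i ≤ (f i - c i j • f j)⁺ := fun i j hj =>
    posPart_mono (sub_le_sub_left (Finset.single_le_sum (f := fun j => c i j • f j)
      (fun j _ => hcf i j) (Finset.mem_range.2 hj)) _)
  have hlt : ∀ i < n, ∀ j < n, i < j → g i ⊓ g j = 0 := by
    intro i hi j hj hij
    refine le_antisymm ?_ (le_inf (hg0 i) (hg0 j))
    rw [← posPart_sub_smul_inf_eq_zero hK1 (f i) (f j)]
    refine inf_le_inf ((hgle i j hj).trans_eq ?_) ((hgle j i hi).trans_eq ?_)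
    · simp [hc, hij, hij.not_gt]
    · simp [hc, hij]
  have hsum := hdisj g hg0 hg1 fun i hi j hj hij => by
    rcases lt_or_gt_of_ne hij with h | h
    · exact hlt i hi j hj h
    · rw [inf_comm]; exact hlt j hj i hi h
  have hlow : ∀ i, ε / 4 ≤ φ i (g i) := by
    intro i
    have h1 : φ i (∑ j ∈ Finset.range n, c i j • f j) ≤ n * (ε / (4 * n)) := by
      rw [map_sum]
      refine (Finset.sum_le_card_nsmul _ _ (ε / (4 * n)) fun j _ => ?_).trans_eq (by simp)
      rw [map_smul, smul_eq_mul]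
      simp only [hc]
      split_ifs with hji hij
      · calc K * φ i (f j) ≤ K * η := by gcongr; exact (hφη j i hji).le
          _ = ε / (4 * n) := by rw [hη]; field_simp
      · have h2 : φ i (f j) ≤ B := by
          refine (hφ0 i _ (hf0 j)).trans ((le_abs_self _).trans ((φ₀.le_opNorm _).trans ?_))
          exact mul_le_of_le_one_right hB0 (hf1 j)
        rw [inv_mul_le_iff₀ hK0]
        refine h2.trans ?_
        rw [hK, add_mul]
        have : 4 * n * B / ε * (ε / (4 * n)) = B := by field_simp
        rw [this]
        have : 0 ≤ ε / (4 * n) := by positivity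
        linarith
      · rw [zero_mul]; positivity
    have h2 : n * (ε / (4 * n)) = ε / 4 := by field_simp
    have h3 := apply_mono (hpos _ (hφD i)) (le_posPart (f i - ∑ j ∈ Finset.range n, c i j • f j))
    rw [map_sub] at h3
    have := hφf i
    linarith
  have h1 : n * (ε / 4) ≤ φ₀ (∑ i ∈ Finset.range n, g i) := by
    rw [map_sum]
    refine le_trans (by simp) (Finset.card_nsmul_le_sum _ _ (ε / 4) fun i _ =>
      (hlow i).trans (hφ0 i _ (hg0 i)))
  have h2 : φ₀ (∑ i ∈ Finset.range n, g i) ≤ B * (ε / (8 * (B + 1)) * n) :=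
    (le_abs_self _).trans ((φ₀.le_opNorm _).trans (mul_le_mul_of_nonneg_left hsum hB0))
  have h3 : B * (ε / (8 * (B + 1)) * n) ≤ n * (ε / 8) := by
    have : B * (ε / (8 * (B + 1)) * n) = n * (ε / 8) * (B / (B + 1)) := by field_simp
    rw [this]
    exact mul_le_of_le_one_right (by positivity) ((div_le_one (by positivity)).2 (by linarith))
  have h4 : n * (ε / 8) < n * (ε / 4) := by gcongr; norm_num
  linarith

end NormedLattice

/-! ### Geometric decay of `ψ` under repeated halving. -/

section Decay

variable {γ : ℝ≥0∞} {ψ : ℝ → ℝ}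

theorem ioo_subset_ico : ioo γ ⊆ ico γ := fun _ ht => ⟨ht.1.le, ht.2⟩

theorem mem_ioo_of_le {s t : ℝ} (ht : t ∈ ioo γ) (hs : 0 < s) (hst : s ≤ t) : s ∈ ioo γ :=
  ⟨hs, (ENNReal.ofReal_le_ofReal hst).trans_lt ht.2⟩

theorem div_two_pow_mem_ioo {t : ℝ} (ht : t ∈ ioo γ) (k : ℕ) : t / 2 ^ k ∈ ioo γ :=
  mem_ioo_of_le ht (div_pos ht.1 (by positivity))
    (div_le_self ht.1.le (one_le_pow₀ one_le_two))

/-- Concavity and `ψ 0 = 0` give `ψ t ≥ (t / s) ψ s` for `t ≤ s`; to the right of a point where `ψ`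
is positive, monotonicity suffices. -/
theorem pos_of_concaveOn (hψ_nonneg : ∀ t ∈ ico γ, 0 ≤ ψ t) (hψ_ne : ∃ t ∈ ico γ, ψ t ≠ 0)
    (hψ_mono : MonotoneOn ψ (ico γ)) (hψ_conc : ConcaveOn ℝ (ico γ) ψ) (hψ_zero : ψ 0 = 0)
    {t : ℝ} (ht : t ∈ ioo γ) : 0 < ψ t := by
  obtain ⟨s, hs, hne⟩ := hψ_ne
  have hs0 : 0 < ψ s := lt_of_le_of_ne (hψ_nonneg s hs) hne.symm
  rcases le_total s t with hst | hts
  · exact hs0.trans_le (hψ_mono hs (ioo_subset_ico ht) hst)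
  have hspos : 0 < s := ht.1.trans_le hts
  have h0 : (0 : ℝ) ∈ ico γ := ⟨le_rfl, (ENNReal.ofReal_le_ofReal hs.1).trans_lt hs.2⟩
  have hts1 : t / s ≤ 1 := (div_le_one hspos).2 hts
  have h := hψ_conc.2 hs h0 (div_pos ht.1 hspos).le (sub_nonneg.2 hts1) (add_sub_cancel _ _)
  simp only [smul_eq_mul, mul_zero, add_zero, hψ_zero, div_mul_cancel₀ _ hspos.ne'] at h
  exact (mul_pos (div_pos ht.1 hspos) hs0).trans_le h

/-- If `ψ s ≤ q ψ (2s)` for all small and all large `s`, then `ψ` decays geometrically along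
`t / 2 ^ k`, uniformly in `t`. -/
theorem exists_forall_div_two_pow_le (hψ_nonneg : ∀ t ∈ ico γ, 0 ≤ ψ t)
    (hψ_mono : MonotoneOn ψ (ico γ)) {q t₀ T : ℝ} (hq0 : 0 < q) (hq1 : q < 1) (ht₀ : 0 < t₀)
    (hsmall : ∀ s, s < t₀ → 2 * s ∈ ioo γ → ψ s ≤ q * ψ (2 * s))
    (hlarge : ∀ s, T ≤ s → 2 * s ∈ ioo γ → ψ s ≤ q * ψ (2 * s)) :
    ∃ A : ℝ, 0 < A ∧ ∀ k : ℕ, ∀ t ∈ ioo γ, ψ (t / 2 ^ k) ≤ A * q ^ k * ψ t := by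
  have hnn : ∀ t ∈ ioo γ, 0 ≤ ψ t := fun t ht => hψ_nonneg t (ioo_subset_ico ht)
  have hmono : ∀ t ∈ ioo γ, ∀ k : ℕ, ψ (t / 2 ^ k) ≤ ψ t := fun t ht k =>
    hψ_mono (ioo_subset_ico (div_two_pow_mem_ioo ht k)) (ioo_subset_ico ht)
      (div_le_self ht.1.le (one_le_pow₀ one_le_two))
  have hnear : ∀ k : ℕ, ∀ t ∈ ioo γ, t < t₀ → ψ (t / 2 ^ k) ≤ q ^ k * ψ t := by
    intro k t ht htt
    induction k with
    | zero => simp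
    | succ k ih =>
      have h2 : 2 * (t / 2 ^ (k + 1)) = t / 2 ^ k := by field_simp; ring
      have h3 : t / 2 ^ (k + 1) < t₀ :=
        (div_le_self ht.1.le (one_le_pow₀ one_le_two)).trans_lt htt
      have h4 := hsmall _ h3 (by rw [h2]; exact div_two_pow_mem_ioo ht k)
      rw [h2] at h4
      calc _ ≤ _ := h4
        _ ≤ q * (q ^ k * ψ t) := by gcongr
        _ = _ := by ring
  -- At most `m` halvings carry any `t < 2 * T` below `t₀`. Those steps may gain nothing, which
  -- costs the constant `(q ^ m)⁻¹`.
  obtain ⟨m, hm⟩ := pow_unbounded_of_one_lt (2 * T / t₀) one_lt_two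
  rw [div_lt_iff₀ ht₀] at hm
  have hmid : ∀ k : ℕ, ∀ t ∈ ioo γ, t < 2 * T → ψ (t / 2 ^ k) ≤ (q ^ m)⁻¹ * q ^ k * ψ t := by
    intro k t ht htT
    rcases le_total k m with hkm | hmk
    · refine (hmono t ht k).trans (le_mul_of_one_le_left (hnn t ht) ?_)
      rw [← div_eq_inv_mul, one_le_div (by positivity)]
      exact pow_le_pow_of_le_one hq0.le hq1.le hkm
    · obtain ⟨l, rfl⟩ := Nat.exists_eq_add_of_le hmk
      have h1 : t / 2 ^ m < t₀ := by
        rw [div_lt_iff₀ (by positivity)]; linarith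
      have h2 := hnear l _ (div_two_pow_mem_ioo ht m) h1
      rw [div_div, ← pow_add] at h2
      refine h2.trans ?_
      have : (q ^ m)⁻¹ * q ^ (m + l) = q ^ l := by rw [pow_add]; field_simp
      rw [this]
      gcongr
      exact hmono t ht m
  refine ⟨(q ^ m)⁻¹, by positivity, fun k => ?_⟩
  -- Here `t` varies with `k`: above `2 * T` one halving gains a factor `q`, and below it `hmid`
  -- finishes.
  induction k with
  | zero =>
    intro t ht
    have h1 : 1 ≤ (q ^ m)⁻¹ := (one_le_inv₀ (by positivity)).2 (pow_le_one₀ hq0.le hq1.le)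
    simpa using le_mul_of_one_le_left (hnn t ht) h1
  | succ k ih =>
    intro t ht
    rcases lt_or_ge t (2 * T) with htT | hTt
    · exact hmid _ t ht htT
    have h2 : 2 * (t / 2) = t := by ring
    have h1 := hlarge (t / 2) (by linarith) (by rwa [h2])
    rw [h2] at h1
    have h3 := ih (t / 2) (mem_ioo_of_le ht (half_pos ht.1) (half_le_self ht.1.le))
    rw [div_div, ← pow_succ'] at h3
    calc _ ≤ _ := h3
      _ ≤ (q ^ m)⁻¹ * q ^ k * (q * ψ t) := by gcongr
      _ = _ := by ring

theorem exists_eventually_le_mul_of_one_lt_liminf {l : Filter ℝ}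
    (h : (1 : EReal) < liminf (fun t : ℝ => ((ψ (2 * t) / ψ t : ℝ) : EReal)) l) :
    ∃ q : ℝ, 0 < q ∧ q < 1 ∧ ∀ᶠ t in l, 0 < ψ t → ψ t ≤ q * ψ (2 * t) := by
  obtain ⟨c, hc1, hc⟩ := EReal.lt_iff_exists_real_btwn.1 h
  have hc1' : (1 : ℝ) < c := by exact_mod_cast hc1
  have hc0 : 0 < c := one_pos.trans hc1'
  refine ⟨c⁻¹, by positivity, inv_lt_one_of_one_lt₀ hc1', ?_⟩
  filter_upwards [eventually_lt_of_lt_liminf hc] with t ht hpos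
  have h1 : c < ψ (2 * t) / ψ t := by exact_mod_cast ht
  rw [lt_div_iff₀ hpos] at h1
  rw [le_inv_mul_iff₀ hc0]
  exact h1.le

theorem exists_decay (hψ_nonneg : ∀ t ∈ ico γ, 0 ≤ ψ t)
    (hψ_mono : MonotoneOn ψ (ico γ)) (hψ_pos : ∀ t ∈ ioo γ, 0 < ψ t)
    (hAB : ConditionA γ ψ ∨ ConditionB γ ψ) :
    ∃ A q : ℝ, 0 < A ∧ 0 < q ∧ q < 1 ∧
      ∀ k : ℕ, ∀ t ∈ ioo γ, ψ (t / 2 ^ k) ≤ A * q ^ k * ψ t := by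
  have hhalf : ∀ s, 2 * s ∈ ioo γ → s ∈ ioo γ := fun s hs =>
    mem_ioo_of_le hs (by linarith [hs.1]) (by linarith [hs.1])
  have hzero : ∀ {q : ℝ}, (∀ᶠ t in 𝓝[>] (0 : ℝ), 0 < ψ t → ψ t ≤ q * ψ (2 * t)) →
      ∃ t₀ > 0, ∀ s, s < t₀ → 2 * s ∈ ioo γ → ψ s ≤ q * ψ (2 * s) := by
    intro q h
    obtain ⟨t₀, ht₀, h1⟩ := mem_nhdsGT_iff_exists_Ioo_subset.1 h
    exact ⟨t₀, ht₀, fun s hs h2 => h1 ⟨(hhalf s h2).1, hs⟩ (hψ_pos s (hhalf s h2))⟩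
  rcases hAB with ⟨-, h0, h1⟩ | ⟨hfin, h0⟩
  · obtain ⟨q, hq0, hq1, hq⟩ := exists_eventually_le_mul_of_one_lt_liminf h0
    obtain ⟨q', hq0', hq1', hq'⟩ := exists_eventually_le_mul_of_one_lt_liminf h1
    obtain ⟨t₀, ht₀, hs⟩ := hzero hq
    obtain ⟨T, hT⟩ := eventually_atTop.1 hq'
    obtain ⟨A, hA, h⟩ := exists_forall_div_two_pow_le hψ_nonneg hψ_mono (q := max q q') (T := T)
      (lt_max_of_lt_left hq0) (max_lt hq1 hq1') ht₀
      (fun s hst h2 => (hs s hst h2).trans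
        (mul_le_mul_of_nonneg_right (le_max_left _ _) (hψ_pos _ h2).le))
      (fun s hst h2 => (hT s hst (hψ_pos s (hhalf s h2))).trans
        (mul_le_mul_of_nonneg_right (le_max_right _ _) (hψ_pos _ h2).le))
    exact ⟨A, _, hA, lt_max_of_lt_left hq0, max_lt hq1 hq1', h⟩
  · obtain ⟨q, hq0, hq1, hq⟩ := exists_eventually_le_mul_of_one_lt_liminf h0
    obtain ⟨t₀, ht₀, hs⟩ := hzero hq
    -- With `T = γ` the requirement at large arguments is vacuous.
    obtain ⟨A, hA, h⟩ := exists_forall_div_two_pow_le hψ_nonneg hψ_mono (T := γ.toReal)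
      hq0 hq1 ht₀ hs (fun s hst h2 => by
        have h3 := (hhalf s h2).2
        rw [← ENNReal.ofReal_toReal hfin.ne] at h3
        exact absurd (ENNReal.ofReal_le_ofReal hst) (not_le.2 h3))
    exact ⟨A, q, hA, hq0, hq1, h⟩

end Decay

/-! ### Rearrangements of disjoint sums and dyadic estimates. -/

section Disjoint

variable {α : Type*} [MeasurableSpace α] {μ : Measure α}

/-- At almost every point of the superlevel set the sum equals one of its terms; `0 ≤ r` ensures
that this term is nonzero. -/
theorem distribFun_sum_le_of_disjoint {n : ℕ} {g : ℕ → α → ℝ}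
    (hg : ∀ᵐ x ∂μ, ∀ i < n, ∀ j < n, i ≠ j → g i x = 0 ∨ g j x = 0) {r : ℝ} (hr : 0 ≤ r) :
    distribFun μ (fun x => ∑ i ∈ Finset.range n, g i x) r ≤
      ∑ i ∈ Finset.range n, distribFun μ (g i) r := by
  refine le_trans (measure_mono_ae ?_) (measure_biUnion_finset_le (Finset.range n) _)
  filter_upwards [hg] with x hx hrx
  have hrx' : r < |∑ i ∈ Finset.range n, g i x| := hrx
  have hne : ∑ i ∈ Finset.range n, g i x ≠ 0 := fun h0 => by
    rw [h0, abs_zero] at hrx'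
    exact absurd hr (not_le.2 hrx')
  obtain ⟨i, hi, hgi⟩ := Finset.exists_ne_zero_of_sum_ne_zero hne
  have hsum : ∑ j ∈ Finset.range n, g j x = g i x :=
    Finset.sum_eq_single_of_mem i hi fun j hj hji =>
      (hx i (Finset.mem_range.1 hi) j (Finset.mem_range.1 hj) hji.symm).resolve_left hgi
  rw [hsum] at hrx'
  exact mem_iUnion₂.2 ⟨i, hi, hrx'⟩

theorem ofReal_mul_rearr_le_rearrInt (f : α → ℝ) (t : ℝ) :
    ENNReal.ofReal t * rearr μ f t ≤ rearrInt μ f t := by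
  have h : ∫⁻ _ in Ioc 0 t, rearr μ f t ≤ rearrInt μ f t :=
    setLIntegral_mono' measurableSet_Ioc fun s hs => rearr_antitone μ f hs.2
  refine le_trans (le_of_eq ?_) h
  simp [mul_comm]

/-- If `∫_0^t f^* ≤ a` then `d_{|f|}(a / t) ≤ t`. -/
theorem distribFun_le_of_rearrInt_le {f : α → ℝ} {t a : ℝ} (ht : 0 < t) (ha : 0 ≤ a)
    (h : rearrInt μ f t ≤ ENNReal.ofReal a) : distribFun μ f (a / t) ≤ ENNReal.ofReal t := by
  have h1 : rearr μ f t ≤ ENNReal.ofReal (a / t) := by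
    rw [ENNReal.ofReal_div_of_pos ht, ENNReal.le_div_iff_mul_le (by simp [ht]) (by simp), mul_comm]
    exact (ofReal_mul_rearr_le_rearrInt f t).trans h
  rw [ENNReal.ofReal_eq_coe_nnreal (div_nonneg ha ht.le)] at h1
  exact (rearr_le_iff μ f t _).1 h1

theorem Ioc_zero_subset_iUnion_dyadic (t : ℝ) :
    Ioc 0 t ⊆ ⋃ k : ℕ, Ioc (t / 2 ^ (k + 1)) (t / 2 ^ k) := by
  intro s hs
  have hex : ∃ k : ℕ, t / 2 ^ (k + 1) < s := by
    obtain ⟨k, hk⟩ := pow_unbounded_of_one_lt (t / s) one_lt_two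
    refine ⟨k, ?_⟩
    rw [div_lt_iff₀ hs.1] at hk
    rw [div_lt_iff₀ (by positivity), pow_succ]
    have : 0 < 2 ^ k * s := mul_pos (by positivity) hs.1
    linarith
  classical
  -- The least such `k` works: minimality gives `s ≤ t / 2 ^ k`, and for `k = 0` this is `s ≤ t`.
  refine mem_iUnion.2 ⟨Nat.find hex, Nat.find_spec hex, ?_⟩
  rcases h : Nat.find hex with _ | k
  · simpa using hs.2
  · exact not_lt.1 (Nat.find_min hex (h ▸ k.lt_succ_self))

/-- On each dyadic interval the decreasing `f^*` is at most its value at the left endpoint, which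
equals the length of the interval. -/
theorem rearrInt_le_tsum_dyadic (f : α → ℝ) (t : ℝ) :
    rearrInt μ f t ≤
      ∑' k : ℕ, ENNReal.ofReal (t / 2 ^ (k + 1)) * rearr μ f (t / 2 ^ (k + 1)) := by
  refine (lintegral_mono_set (Ioc_zero_subset_iUnion_dyadic t)).trans
    ((lintegral_iUnion_le _ _).trans (ENNReal.tsum_le_tsum fun k => ?_))
  have h : ∫⁻ s in Ioc (t / 2 ^ (k + 1)) (t / 2 ^ k), rearr μ f s ≤
      ∫⁻ _ in Ioc (t / 2 ^ (k + 1)) (t / 2 ^ k), rearr μ f (t / 2 ^ (k + 1)) :=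
    setLIntegral_mono' measurableSet_Ioc fun s hs => rearr_antitone μ f hs.1.le
  refine h.trans (le_of_eq ?_)
  rw [setLIntegral_const, Real.volume_Ioc, mul_comm]
  congr 2
  field_simp
  ring

end Disjoint

/-! ### Disjoint sums in the Marcinkiewicz space. -/

section Space

variable {γ : ℝ≥0∞} {ψ : ℝ → ℝ}

instance : PosSMulMono ℝ (Marcinkiewicz γ ψ) where
  smul_le_smul_of_nonneg_left c hc f g h := by
    have h' : (f : L0 γ) ≤ g := h
    change (c • f : L0 γ) ≤ (c • g : L0 γ)
    rw [← AEEqFun.coeFn_le] at h' ⊢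
    filter_upwards [h', AEEqFun.coeFn_smul c (f : L0 γ), AEEqFun.coeFn_smul c (g : L0 γ)]
      with x hx h1 h2
    rw [h1, h2]
    exact mul_le_mul_of_nonneg_left hx hc

theorem coeFn_sum_range (g : ℕ → L0 γ) (n : ℕ) :
    ∀ᵐ x ∂leb γ, (∑ i ∈ Finset.range n, g i : L0 γ) x = ∑ i ∈ Finset.range n, g i x := by
  induction n with
  | zero =>
    filter_upwards [AEEqFun.coeFn_zero (α := ℝ) (μ := leb γ) (β := ℝ)] with x hx
    simpa using hx
  | succ n ih =>
    filter_upwards [ih, AEEqFun.coeFn_add (∑ i ∈ Finset.range n, g i) (g n)] with x h1 h2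
    rw [Finset.sum_range_succ, Finset.sum_range_succ, h2, Pi.add_apply, h1]

theorem rearrInt_le_of_norm_le_one (hψ_pos : ∀ t ∈ ioo γ, 0 < ψ t) {f : Marcinkiewicz γ ψ}
    (hf : ‖f‖ ≤ 1) {t : ℝ} (ht : t ∈ ioo γ) :
    rearrInt (leb γ) (f : L0 γ) t ≤ ENNReal.ofReal (ψ t) := by
  have h1 : mnorm γ ψ (f : L0 γ) ≤ 1 := by
    rw [norm_def] at hf
    exact (ENNReal.toReal_le_toReal f.2.ne ENNReal.one_ne_top).1 (by simpa using hf)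
  have h2 : rearrInt (leb γ) (f : L0 γ) t / ENNReal.ofReal (ψ t) ≤ 1 :=
    (le_iSup₂ (f := fun t (_ : t ∈ ioo γ) =>
      rearrInt (leb γ) (f : L0 γ) t / ENNReal.ofReal (ψ t)) t ht).trans h1
  rwa [ENNReal.div_le_iff (by simpa using hψ_pos t ht) ENNReal.ofReal_ne_top, one_mul] at h2

/-- Geometric decay of `ψ` bounds the norm of a sum of `2 ^ N` disjoint elements of the unit
ball. -/
theorem norm_sum_le_of_disjoint (hψ_pos : ∀ t ∈ ioo γ, 0 < ψ t) {A q : ℝ} (hA : 0 < A)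
    (hq0 : 0 < q) (hq1 : q < 1)
    (hdecay : ∀ k : ℕ, ∀ t ∈ ioo γ, ψ (t / 2 ^ k) ≤ A * q ^ k * ψ t) (N : ℕ)
    {g : ℕ → Marcinkiewicz γ ψ} (hg1 : ∀ i, ‖g i‖ ≤ 1)
    (hdisj : ∀ i < 2 ^ N, ∀ j < 2 ^ N, i ≠ j → g i ⊓ g j = 0) :
    ‖∑ i ∈ Finset.range (2 ^ N), g i‖ ≤ 2 ^ N * (A * q ^ (N + 1) * (1 - q)⁻¹) := by
  have hq1' : 0 < 1 - q := sub_pos.2 hq1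
  have hdisj' : ∀ᵐ x ∂leb γ, ∀ i < 2 ^ N, ∀ j < 2 ^ N, i ≠ j →
      (g i : L0 γ) x = 0 ∨ (g j : L0 γ) x = 0 := by
    refine ae_all_iff.2 fun i => ?_
    refine eventually_imp_distrib_left.2 fun hi => ae_all_iff.2 fun j => ?_
    refine eventually_imp_distrib_left.2 fun hj => eventually_imp_distrib_left.2 fun hij => ?_
    have h0 : (g i : L0 γ) ⊓ (g j : L0 γ) = 0 := congrArg Subtype.val (hdisj i hi j hj hij)
    filter_upwards [AEEqFun.coeFn_inf (g i : L0 γ) (g j : L0 γ),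
      AEEqFun.coeFn_zero (α := ℝ) (μ := leb γ) (β := ℝ)] with x h1 h2
    rw [h0, h2] at h1
    rcases min_choice ((g i : L0 γ) x) ((g j : L0 γ) x) with h | h
    · left; rw [← h]; exact h1.symm
    · right; rw [← h]; exact h1.symm
  set C : ℝ := 2 ^ N * (A * q ^ (N + 1) * (1 - q)⁻¹) with hC
  have hC0 : 0 ≤ C := by positivity
  have hmn : mnorm γ ψ ((∑ i ∈ Finset.range (2 ^ N), g i : Marcinkiewicz γ ψ) : L0 γ) ≤
      ENNReal.ofReal C := by
    refine iSup₂_le fun t ht => ?_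
    rw [ENNReal.div_le_iff (by simpa using hψ_pos t ht) ENNReal.ofReal_ne_top,
      ← ENNReal.ofReal_mul hC0]
    set h : ℝ → ℝ := fun x => ∑ i ∈ Finset.range (2 ^ N), (g i : L0 γ) x with hh
    have hle : rearrInt (leb γ) ((∑ i ∈ Finset.range (2 ^ N), g i : Marcinkiewicz γ ψ) : L0 γ) t ≤
        rearrInt (leb γ) h t := by
      refine rearrInt_mono ?_ t
      filter_upwards [coeFn_sum_range (fun i => (g i : L0 γ)) (2 ^ N)] with x hx
      rw [Submodule.coe_sum, hx]
    refine hle.trans ((rearrInt_le_tsum_dyadic h t).trans ?_)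
    have hterm : ∀ k : ℕ,
        ENNReal.ofReal (t / 2 ^ (k + 1)) * rearr (leb γ) h (t / 2 ^ (k + 1)) ≤
          ENNReal.ofReal (2 ^ N * (A * q ^ (N + 1) * ψ t) * q ^ k) := by
      intro k
      -- This scale makes `2 ^ N * u` the dyadic endpoint `t / 2 ^ (k + 1)`: each of the `2 ^ N`
      -- terms exceeds `ψ u / u` on a set of measure at most `u`.
      set u : ℝ := t / 2 ^ (k + 1 + N) with hu
      have humem : u ∈ ioo γ := div_two_pow_mem_ioo ht _
      have hψu := hψ_pos u humem
      have hus : t / 2 ^ (k + 1) = 2 ^ N * u := by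
        rw [hu, pow_add _ (k + 1) N]; field_simp
      have hdist : distribFun (leb γ) h (ψ u / u) ≤ ENNReal.ofReal (2 ^ N * u) := by
        refine (distribFun_sum_le_of_disjoint hdisj' (div_pos hψu humem.1).le).trans ?_
        refine (Finset.sum_le_card_nsmul _ _ (ENNReal.ofReal u) fun i _ =>
          distribFun_le_of_rearrInt_le humem.1 hψu.le
            (rearrInt_le_of_norm_le_one hψ_pos (hg1 i) humem)).trans (le_of_eq ?_)
        rw [ENNReal.ofReal_mul (by positivity), Finset.card_range, nsmul_eq_mul,
          ENNReal.ofReal_pow zero_le_two]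
        simp
      have hre : rearr (leb γ) h (2 ^ N * u) ≤ ENNReal.ofReal (ψ u / u) := by
        rw [ENNReal.ofReal_eq_coe_nnreal (div_pos hψu humem.1).le]
        exact (rearr_le_iff _ _ _ _).2 hdist
      rw [hus]
      refine (mul_le_mul_right hre _).trans ?_
      have hu0 := humem.1
      rw [← ENNReal.ofReal_mul (by positivity)]
      refine ENNReal.ofReal_le_ofReal ?_
      calc 2 ^ N * u * (ψ u / u) = 2 ^ N * ψ u := by field_simp
        _ ≤ 2 ^ N * (A * q ^ (k + 1 + N) * ψ t) := by gcongr; exact hdecay _ t ht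
        _ = _ := by ring
    refine (ENNReal.tsum_le_tsum hterm).trans ?_
    have hψt := hψ_pos t ht
    rw [← ENNReal.ofReal_tsum_of_nonneg (fun k => by positivity)
      ((summable_geometric_of_lt_one hq0.le hq1).mul_left _), tsum_mul_left,
      tsum_geometric_of_lt_one hq0.le hq1]
    refine ENNReal.ofReal_le_ofReal (le_of_eq ?_)
    rw [hC]
    ring
  rw [norm_def]
  exact ENNReal.toReal_le_of_le_ofReal hC0 hmn

end Space

end Marc

theorem proposition3 (γ : ℝ≥0∞) (hγ : 0 < γ) (ψ : ℝ → ℝ)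
    (hψ_nonneg : ∀ t ∈ Marc.ico γ, 0 ≤ ψ t)
    (hψ_ne : ∃ t ∈ Marc.ico γ, ψ t ≠ 0)
    (hψ_mono : MonotoneOn ψ (Marc.ico γ))
    (hψ_conc : ConcaveOn ℝ (Marc.ico γ) ψ)
    (hψ_cont : ContinuousOn ψ (Marc.ioo γ))
    (hψ_zero : ψ 0 = 0)
    (hAB : Marc.ConditionA γ ψ ∨ Marc.ConditionB γ ψ) :
    Marc.HasOrderContinuousNorm (StrongDual ℝ (Marc.Marcinkiewicz γ ψ)) := by
  have hψ_pos : ∀ t ∈ Marc.ioo γ, 0 < ψ t := fun t ht =>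
    Marc.pos_of_concaveOn hψ_nonneg hψ_ne hψ_mono hψ_conc hψ_zero ht
  obtain ⟨A, q, hA, hq0, hq1, hdecay⟩ := Marc.exists_decay hψ_nonneg hψ_mono hψ_pos hAB
  refine Marc.hasOrderContinuousNorm_dual fun ε hε => ?_
  have hq1' : 0 < 1 - q := sub_pos.2 hq1
  -- Chosen so that `A q ^ N / (1 - q) < ε`, which dominates the bound for the average of `2 ^ N`
  -- disjoint elements.
  obtain ⟨N, hN⟩ := exists_pow_lt_of_lt_one (show 0 < ε * (1 - q) / A by positivity) hq1
  refine ⟨2 ^ N, by positivity, fun g _ hg1 hdisj => ?_⟩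
  refine (Marc.norm_sum_le_of_disjoint hψ_pos hA hq0 hq1 hdecay N hg1 hdisj).trans ?_
  rw [Nat.cast_pow, Nat.cast_ofNat, mul_comm]
  gcongr
  rw [← div_eq_mul_inv, div_le_iff₀ hq1', mul_comm A, ← le_div_iff₀ hA]
  exact (pow_le_pow_of_le_one hq0.le hq1.le N.le_succ).trans hN.le
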